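/- Let $T>0$ and let $y=\{y(u,t),\ u\in[0,1],\ t\in[0,T]\}$, defined on a probability space, be a random element of the Skorohod space $D([0,1],C[0,T])$ (the right continuous functions with left limits from $[0,1]$ to $C[0,T]$ with the uniform distance), and put $\mathcal F_t=\sigma(y(u,s),\ u\in[0,1],\ s\le t)$. Assume that - (C1) for every $u\in[0,1]$ the process $y(u,\cdot)$ is a continuous square integrable $(\mathcal F_t)$-martingale; - (C2) $y(u,0)=u$ for all $u\in[0,1]$; - (C3) $y(u,t)\le y(v,t)$ for all $u<v$ in $[0,1]$ and $t\in[0,T]$; - (C4) for every $u\in[0,1]$ the quadratic variation is $\langle y(u,\cdot)\rangle_t=\int_0^t\frac{ds}{m(u,s)}$, $t\in[0,T]$ (in particular this integral is finite), where $m(u,t)=\mathrm{Leb}\{v\in[0,1]:\ \exists s\le t,\ y(v,s)=y(u,s)\}$; - (C5) for all $u,v\in[0,1]$ and $t\in[0,T]$, $\langle y(u,\cdot),y(v,\cdot)\rangle_{t\wedge\tau_{u,v}}=0$, where $\tau_{u,v}=\inf\{t:\ y(u,t)=y(v,t)\}\wedge T$. (Equalities and inequalities between random variables are meant almost surely.)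 For a sequence $(u_k)_{k\ge1}$ in $[0,1]$ put $\tau(u_1)=T$ and $\tau(u_k)=\inf\{t:\ \exists l<k,\ y(u_l,t)=y(u_k,t)\}\wedge T$ for $k\ge2$. Let $\varphi:\mathbb R\to\mathbb R$ be bounded and continuous and let $t\in[0,T]$. Then: 1. Almost surely $m(u,s)>0$ for almost all $(u,s)\in[0,1]\times[0,t]$, and $\frac{\varphi(y(u,s))}{m(u,s)}$ is integrable on $[0,1]\times[0,t]$. 2. For every sequence $(u_k)_{k\ge1}$ that is dense in $[0,1]$, the series $\sum_{k=1}^{\infty}\int_0^{\tau(u_k)\wedge t}\varphi(y(u_k,s))\,ds$ converges (absolutely) almost surely. 3. Its sum does not depend on the dense sequence: the sums for two dense sequences are almost surely equal. 4. For every dense sequence $(u_k)_{k\ge1}$, almost surely $$\sum_{k=1}^{\infty}\int_0^{\tau(u_k)\wedge t}\varphi(y(u_k,s))\,ds=\int_0^1\int_0^t\frac{\varphi(y(u,s))}{m(u,s)}\,ds\,du .$$ 5. Consequently the integral $\int_0^1\int_0^{\tau(u)\wedge t}\varphi(y(u,s))\,ds$, defined as the random variable, unique up to almost sure equality, that for every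 dense sequence $(u_k)_{k\ge 1}$ is almost surely the sum of this series, exists, and almost surely $$\int_0^1\int_0^t\frac{\varphi(y(u,s))}{m(u,s)}\,ds\,du=\int_0^1\int_0^{\tau(u)\wedge t}\varphi(y(u,s))\,ds .$$ -/

import Mathlib

open MeasureTheory ProbabilityTheory Filter Set Topology
open scoped ENNReal

namespace HeavyFlow

/-- A function on `[0,1]` that is right continuous and has left limits. -/
def IsCadlag {E : Type*} [TopologicalSpace E] (f : unitInterval → E) : Prop :=
  ∀ u, ContinuousWithinAt f (Ici u) u ∧ ∃ l, Tendsto f (𝓝[<] u) (𝓝 l)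

/-- `y` is a random element of the Skorohod space `D([0,1], C[0,T])`: every path is a càdlàg
function of `u` with values in `C[0,T]` (uniform distance), and all the coordinates `y(u,t)` are
measurable (they generate the Borel σ-algebra of the Skorohod topology, as `C[0,T]` is
separable). -/
structure IsRandomElement {Ω : Type*} [MeasurableSpace Ω] {T : ℝ}
    (y : Ω → unitInterval → C(Icc (0 : ℝ) T, ℝ)) : Prop where
  cadlag : ∀ ω, IsCadlag (y ω)
  measurable_coord : ∀ u t, Measurable (fun ω => y ω u t)

/-- The filtration `ℱ_t = σ(y(u,s), u ∈ [0,1], s ≤ t)`. -/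
def flowFiltration {Ω : Type*} [mΩ : MeasurableSpace Ω] {T : ℝ}
    (y : Ω → unitInterval → C(Icc (0 : ℝ) T, ℝ)) (hy : IsRandomElement y) :
    Filtration (Icc (0 : ℝ) T) mΩ where
  seq t := ⨆ (u : unitInterval) (s : Icc (0 : ℝ) T) (_ : s ≤ t),
    MeasurableSpace.comap (fun ω => y ω u s) inferInstance
  mono' _ _ h := iSup_mono fun _ => iSup_mono fun _ =>
    iSup_mono' fun hs => ⟨hs.trans h, le_rfl⟩
  le' _ := iSup_le fun u => iSup_le fun s => iSup_le fun _ =>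
    (hy.measurable_coord u s).comap_le

/-- Lebesgue measure on `[0,T]`. -/
noncomputable def timeMeasure (T : ℝ) : Measure (Icc (0 : ℝ) T) :=
  (volume : Measure ℝ).comap Subtype.val

instance (T : ℝ) : IsFiniteMeasure (timeMeasure T) := by
  constructor
  rw [timeMeasure,
    MeasurableEmbedding.comap_apply (MeasurableEmbedding.subtype_coe measurableSet_Icc),
    image_univ, Subtype.range_coe]
  exact measure_Icc_lt_top

/-- `inf S ∧ T` for a set `S` of times in `[0,T]` (so it is `T` when `S` is empty). -/
noncomputable def firstTime {T : ℝ} (hT : 0 < T) (S : Set (Icc (0 : ℝ) T)) : Icc (0 : ℝ) T :=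
  ⟨sInf (insert T (Subtype.val '' S)), by
    have h0 : ∀ x ∈ insert T (Subtype.val '' S), (0 : ℝ) ≤ x := by
      rintro x (rfl | ⟨s, _, rfl⟩)
      · exact hT.le
      · exact s.2.1
    exact ⟨le_csInf ⟨T, mem_insert _ _⟩ h0, csInf_le ⟨0, h0⟩ (mem_insert _ _)⟩⟩

/-- The meeting time `τ_{u,v} = inf {t : f(u,t) = f(v,t)} ∧ T` of two particles of a
realization `f` of the flow. -/
noncomputable def meetingTime {T : ℝ} (hT : 0 < T)
    (f : unitInterval → C(Icc (0 : ℝ) T, ℝ)) (u v : unitInterval) : Icc (0 : ℝ) T :=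
  firstTime hT {t | f u t = f v t}

/-- The mass `m(u,t) = Leb {v : ∃ s ≤ t, f(v,s) = f(u,s)}`. -/
noncomputable def mass {T : ℝ} (f : unitInterval → C(Icc (0 : ℝ) T, ℝ))
    (u : unitInterval) (t : Icc (0 : ℝ) T) : ℝ≥0∞ :=
  volume {v : unitInterval | ∃ s ≤ t, f v s = f u s}

/-- `∫_0^t ds / m(u,s)`, with values in `[0,∞]` (and `1 / 0 = ∞`). -/
noncomputable def clock {T : ℝ} (f : unitInterval → C(Icc (0 : ℝ) T, ℝ))
    (u : unitInterval) (t : Icc (0 : ℝ) T) : ℝ≥0∞ :=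
  ∫⁻ s in Iic t, (mass f u s)⁻¹ ∂(timeMeasure T)

/-- `A` is (a version of) the joint quadratic variation `⟨M, N⟩` of the continuous square
integrable martingales `M`, `N`: an adapted process of bounded variation with continuous paths
that starts at `0` and makes `M N - A` a martingale. -/
structure IsCovariation {Ω : Type*} [mΩ : MeasurableSpace Ω] {T : ℝ}
    (ℱ : Filtration (Icc (0 : ℝ) T) mΩ) (P : Measure Ω)
    (M N A : Icc (0 : ℝ) T → Ω → ℝ) : Prop where
  adapted : StronglyAdapted ℱ A
  start : ∀ᵐ ω ∂P, ∀ t : Icc (0 : ℝ) T, (t : ℝ) = 0 → A t ω = 0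
  continuous : ∀ᵐ ω ∂P, Continuous (fun t => A t ω)
  boundedVariation : ∀ᵐ ω ∂P, BoundedVariationOn (fun t => A t ω) univ
  martingale : Martingale (fun t ω => M t ω * N t ω - A t ω) ℱ P

/-- `y` is a random element of `D([0,1], C[0,T])` that is a flow of coalescing diffusion
particles whose diffusion rates are inversely proportional to their masses. -/
structure IsFlow {Ω : Type*} [MeasurableSpace Ω] {T : ℝ} (hT : 0 < T) (P : Measure Ω)
    (y : Ω → unitInterval → C(Icc (0 : ℝ) T, ℝ)) : Prop where
  randomElement : IsRandomElement y
  /-- Each `y(u,·)` is a (continuous) martingale for the filtration of the flow, -/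
  martingale : ∀ u, Martingale (fun t ω => y ω u t) (flowFiltration y randomElement) P
  /-- and it is square integrable. -/
  squareIntegrable : ∀ u t, MemLp (fun ω => y ω u t) 2 P
  /-- `y(u,0) = u`. -/
  start : ∀ u, ∀ᵐ ω ∂P, ∀ t : Icc (0 : ℝ) T, (t : ℝ) = 0 → y ω u t = (u : ℝ)
  /-- The particles keep their order. -/
  mono : ∀ u v, u < v → ∀ t, ∀ᵐ ω ∂P, y ω u t ≤ y ω v t
  /-- The integral `∫_0^t ds / m(u,s)` is finite, -/
  clock_ne_top : ∀ u, ∀ᵐ ω ∂P, ∀ t, clock (y ω) u t ≠ ∞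
  /-- and it is the quadratic variation of `y(u,·)`. -/
  quadraticVariation : ∀ u, IsCovariation (flowFiltration y randomElement) P
    (fun t ω => y ω u t) (fun t ω => y ω u t) (fun t ω => (clock (y ω) u t).toReal)
  /-- `⟨y(u,·), y(v,·)⟩` vanishes up to the meeting time of the two particles. -/
  covariation : ∀ u v, ∃ A : Icc (0 : ℝ) T → Ω → ℝ,
    IsCovariation (flowFiltration y randomElement) P
      (fun t ω => y ω u t) (fun t ω => y ω v t) A ∧
    ∀ t, ∀ᵐ ω ∂P, A (min t (meetingTime hT (y ω) u v)) ω = 0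

/-- `τ(u_k) = inf {t : ∃ l < k, f(u_l,t) = f(u_k,t)} ∧ T`; for the first index it is `T`. -/
noncomputable def coalescenceTime {T : ℝ} (hT : 0 < T)
    (f : unitInterval → C(Icc (0 : ℝ) T, ℝ)) (u : ℕ → unitInterval) (k : ℕ) : Icc (0 : ℝ) T :=
  firstTime hT {t | ∃ l < k, f (u l) t = f (u k) t}

/-- The `k`-th term `∫_0^{τ(u_k) ∧ t} φ(f(u_k,s)) ds` of the series. -/
noncomputable def seriesTerm {T : ℝ} (hT : 0 < T)
    (f : unitInterval → C(Icc (0 : ℝ) T, ℝ)) (φ : ℝ → ℝ) (t : Icc (0 : ℝ) T)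
    (u : ℕ → unitInterval) (k : ℕ) : ℝ :=
  ∫ s in Iic (min (coalescenceTime hT f u k) t), φ (f (u k) s) ∂(timeMeasure T)

/-- `∫_0^1 ∫_0^t φ(f(u,s)) / m(u,s) ds du`. -/
noncomputable def massIntegral {T : ℝ} (f : unitInterval → C(Icc (0 : ℝ) T, ℝ))
    (φ : ℝ → ℝ) (t : Icc (0 : ℝ) T) : ℝ :=
  ∫ u : unitInterval, ∫ s in Iic t, φ (f u s) / (mass f u s).toReal ∂(timeMeasure T)

/-- `J` is (a version of) the integral `∫_0^1 ∫_0^{τ(u) ∧ t} φ(y(u,s)) ds`: the random variable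
that is almost surely the sum of the series, whatever dense sequence is used. -/
def IsFlowIntegral {Ω : Type*} [MeasurableSpace Ω] {T : ℝ} (hT : 0 < T) (P : Measure Ω)
    (y : Ω → unitInterval → C(Icc (0 : ℝ) T, ℝ)) (φ : ℝ → ℝ) (t : Icc (0 : ℝ) T)
    (J : Ω → ℝ) : Prop :=
  Measurable J ∧ ∀ u : ℕ → unitInterval, DenseRange u →
    ∀ᵐ ω ∂P, HasSum (seriesTerm hT (y ω) φ t u) (J ω)

end HeavyFlow

/-! For `u < v` the difference of two particles is a nonnegative continuous martingale, so it stays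
at `0` after reaching `0` (`ae_eq_zero_of_eq_zero_of_le`). Hence almost surely the labels of a
countable dense set keep their order and coalesce. Right continuity extends this to all labels up to
a countable set, off which `mass` equals `clusterMass`, the measure of the labels at the same
position at the same time.

The expected quadratic variation of `y(u,·)` is at most `E y(u,t)²`, which order preservation bounds
uniformly in `u` (`IsFlow.lintegral_clock_le`). By Tonelli `1/m` is almost surely integrable on
`[0,1] × [0,t]`, so masses are positive almost everywhere and `φ/m` is integrable.

Finally, in `IsCoalescingPath.hasSum_seriesTerm`, split `[0,1] × [0,t]` by the first `k` such that
`a k` is at the position of `u` at time `s`; a cluster of positive mass contains some `a k`. At a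
fixed `s` the integrand is constant on the cluster of `a k`, and the mass of the cluster cancels the
denominator: this leaves `φ(f(a k, s))` if `a k` has not yet met an earlier label, and `0`
otherwise. So the `k`-th piece is the `k`-th term of the series, whatever the dense sequence. -/

namespace HeavyFlow

/-! ### Absorption of nonnegative continuous martingales at zero -/

section Martingale

variable {Ω ι : Type*} [mΩ : MeasurableSpace Ω] {P : Measure Ω} [LinearOrder ι]
  {ℱ : Filtration ι mΩ} {N : ι → Ω → ℝ}

/-- Split the event by the first time in `S` at which `N ≤ ε`. Each piece is measurable at that
time, so the martingale property replaces `N t` by a value at most `ε`. In the induction the new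
time `a` is the latest one, and `B` is the piece on which it is the first. -/
theorem setIntegral_exists_finset_le [IsFiniteMeasure P] (hN : Martingale N ℱ P) (ε : ℝ) {t : ι}
    (S : Finset ι) (hS : ∀ s ∈ S, s ≤ t) :
    ∫ ω in {ω | ∃ s ∈ S, N s ω ≤ ε}, N t ω ∂P ≤ ε * P.real {ω | ∃ s ∈ S, N s ω ≤ ε} := by
  classical
  induction S using Finset.induction_on_max with
  | empty => simp
  | insert a S ha ih =>
    have hat : a ≤ t := hS a (Finset.mem_insert_self _ _)
    have ih := ih fun s hs => hS s (Finset.mem_insert_of_mem hs)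
    set A : Set Ω := {ω | ∃ s ∈ S, N s ω ≤ ε} with hA
    set B : Set Ω := {ω | N a ω ≤ ε} \ A with hB
    have hAm : MeasurableSet[ℱ a] A := by
      have : A = ⋃ s ∈ S, {ω | N s ω ≤ ε} := by ext; simp [hA]
      rw [this]
      refine Finset.measurableSet_biUnion S fun s hs => ?_
      exact ℱ.mono (ha s hs).le _ ((hN.stronglyMeasurable s).measurable measurableSet_Iic)
    have hBm : MeasurableSet[ℱ a] B :=
      MeasurableSet.diff ((hN.stronglyMeasurable a).measurable measurableSet_Iic) hAm
    have hun : {ω | ∃ s ∈ insert a S, N s ω ≤ ε} = A ∪ B := by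
      ext ω
      by_cases h : ∃ s ∈ S, N s ω ≤ ε <;> simp [hA, hB, h]
    have hdisj : Disjoint A B := disjoint_sdiff_right
    have hBle : ∫ ω in B, N t ω ∂P ≤ ε * P.real B := by
      rw [← hN.setIntegral_eq hat hBm]
      calc ∫ ω in B, N a ω ∂P ≤ ∫ _ in B, ε ∂P :=
            setIntegral_mono_on (hN.integrable a).integrableOn
              (integrable_const ε).integrableOn (ℱ.le a _ hBm) fun ω hω => hω.1
        _ = ε * P.real B := by simp [mul_comm]
    rw [hun, setIntegral_union hdisj (ℱ.le a _ hBm) (hN.integrable t).integrableOn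
      (hN.integrable t).integrableOn, measureReal_union hdisj (ℱ.le a _ hBm), mul_add]
    exact add_le_add ih hBle

theorem setIntegral_exists_nat_le [IsProbabilityMeasure P] (hN : Martingale N ℱ P) {ε : ℝ}
    (hε : 0 ≤ ε) {t : ι} (q : ℕ → ι) (hq : ∀ n, q n ≤ t) :
    ∫ ω in {ω | ∃ n, N (q n) ω ≤ ε}, N t ω ∂P ≤ ε := by
  classical
  let A : ℕ → Set Ω := fun n => {ω | ∃ s ∈ (Finset.range n).image q, N s ω ≤ ε}
  have hun : {ω | ∃ n, N (q n) ω ≤ ε} = ⋃ n, A n := by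
    ext ω
    simp only [A, mem_ofPred_eq, mem_iUnion, Finset.mem_image, Finset.mem_range]
    constructor
    · rintro ⟨n, hn⟩
      exact ⟨n + 1, q n, ⟨n, n.lt_succ_self, rfl⟩, hn⟩
    · rintro ⟨_, _, ⟨n, _, rfl⟩, hn⟩
      exact ⟨n, hn⟩
  have hAm : ∀ n, MeasurableSet (A n) := fun n => by
    have : A n = ⋃ s ∈ (Finset.range n).image q, {ω | N s ω ≤ ε} := by ext; simp [A]
    rw [this]
    exact Finset.measurableSet_biUnion _ fun s _ =>
      ((hN.stronglyMeasurable s).mono (ℱ.le s)).measurable measurableSet_Iic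
  have hmono : Monotone A := by
    rintro m n hmn ω ⟨s, hs, h⟩
    exact ⟨s, Finset.image_subset_image (Finset.range_mono hmn) hs, h⟩
  rw [hun]
  refine le_of_tendsto (tendsto_setIntegral_of_monotone hAm hmono (hN.integrable t).integrableOn)
    (Eventually.of_forall fun n => ?_)
  refine (setIntegral_exists_finset_le hN ε _ ?_).trans
    (mul_le_of_le_one_right hε measureReal_le_one)
  simp only [Finset.mem_image]
  rintro _ ⟨n, _, rfl⟩
  exact hq n

variable [TopologicalSpace ι] [OrderTopology ι] [TopologicalSpace.SeparableSpace ι]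

/-- A nonnegative continuous martingale stays at `0` once it has reached `0`. -/
theorem ae_eq_zero_of_eq_zero_of_le [IsProbabilityMeasure P] (hN : Martingale N ℱ P)
    (hc : ∀ ω, Continuous fun t => N t ω) (h0 : ∀ t, 0 ≤ᵐ[P] N t) :
    ∀ᵐ ω ∂P, ∀ s t, s ≤ t → N s ω = 0 → N t ω = 0 := by
  rcases isEmpty_or_nonempty ι with hι | hι
  · exact Eventually.of_forall fun _ s => hι.elim s
  let q := TopologicalSpace.denseSeq ι
  have hq : DenseRange q := TopologicalSpace.denseRange_denseSeq ι
  have key : ∀ t, ∀ᵐ ω ∂P, ∀ s ≤ t, N s ω = 0 → N t ω = 0 := by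
    intro t
    -- Sampling at `min (q k) t` keeps all times below `t`. By continuity a path that vanishes at
    -- some `s ≤ t` lies in every `A n`, while `N t` has integral at most `1 / (n + 1)` over `A n`.
    let A : ℕ → Set Ω := fun n => {ω | ∃ k, N (min (q k) t) ω ≤ 1 / ((n : ℝ) + 1)}
    have hAm : ∀ n, MeasurableSet (A n) := fun n => by
      have : A n = ⋃ k, {ω | N (min (q k) t) ω ≤ 1 / ((n : ℝ) + 1)} := by ext; simp [A]
      rw [this]
      exact MeasurableSet.iUnion fun k =>
        ((hN.stronglyMeasurable _).mono (ℱ.le _)).measurable measurableSet_Iic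
    have hBm : MeasurableSet (⋂ n, A n) := MeasurableSet.iInter hAm
    have hle : ∫ ω in ⋂ n, A n, N t ω ∂P ≤ 0 := by
      refine ge_of_tendsto tendsto_one_div_add_atTop_nhds_zero_nat
        (Eventually.of_forall fun n => ?_)
      refine le_trans ?_ (setIntegral_exists_nat_le hN (ε := 1 / ((n : ℝ) + 1)) (by positivity)
        (fun k => min (q k) t) fun k => min_le_right _ _)
      exact setIntegral_mono_set (hN.integrable t).integrableOn (ae_restrict_of_ae (h0 t))
        (iInter_subset A n).eventuallyLE
    have hz := (setIntegral_eq_zero_iff_of_nonneg_ae (ae_restrict_of_ae (h0 t))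
      (hN.integrable t).integrableOn).1
      (le_antisymm hle (integral_nonneg_of_ae (ae_restrict_of_ae (h0 t))))
    filter_upwards [(ae_restrict_iff' hBm).1 hz] with ω hω s hst hs
    refine hω (mem_iInter.2 fun n => ?_)
    have hcont : Continuous fun r => N (min r t) ω :=
      (hc ω).comp (continuous_id.min continuous_const)
    obtain ⟨k, hk⟩ := hq.exists_mem_open
      (isOpen_lt hcont (continuous_const (y := 1 / ((n : ℝ) + 1))))
      ⟨s, by simp only [mem_ofPred_eq, min_eq_left hst, hs]; positivity⟩
    exact ⟨k, le_of_lt hk⟩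
  -- Passage to all `t` at once: if `N t ≠ 0`, then `N` is nonzero at some dense time after `s`,
  -- against `key` there.
  filter_upwards [ae_all_iff.2 fun k => key (q k)] with ω hω s t hst hs
  by_contra ht
  have hne : s < t := lt_of_le_of_ne hst (by rintro rfl; exact ht hs)
  obtain ⟨k, hk⟩ := hq.exists_mem_open
    (isOpen_Ioi.inter (isOpen_ne_fun (hc ω) (continuous_const (y := (0 : ℝ))))) ⟨t, hne, ht⟩
  exact hk.2 (hω k s (le_of_lt hk.1) hs)

end Martingale

/-! ### Deterministic geometry of coalescing monotone paths -/

section Paths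

/-- The measure of the set of the particles that are at time `t` at the position of `u`. -/
noncomputable def clusterMass {T : ℝ} (f : unitInterval → C(Icc (0 : ℝ) T, ℝ))
    (u : unitInterval) (t : Icc (0 : ℝ) T) : ℝ≥0∞ :=
  volume {v : unitInterval | f v t = f u t}

/-- A càdlàg path of the flow whose particles with labels in the countable dense set `D` keep
their order and coalesce. -/
structure IsCoalescingPath {T : ℝ} (f : unitInterval → C(Icc (0 : ℝ) T, ℝ))
    (D : Set unitInterval) : Prop where
  cadlag : IsCadlag f
  countable : D.Countable
  dense : Dense D
  one_mem : 1 ∈ D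
  le_of_mem : ∀ u ∈ D, ∀ v ∈ D, u < v → ∀ t, f u t ≤ f v t
  coalesce : ∀ u ∈ D, ∀ v ∈ D, ∀ s t, s ≤ t → f u s = f v s → f u t = f v t

namespace IsCoalescingPath

variable {T : ℝ} {f : unitInterval → C(Icc (0 : ℝ) T, ℝ)} {D : Set unitInterval}

/-- By right continuity, the value at `u` is a limit of values at labels of `D` in `(u,w)`; closed
conditions thus pass from `D` to every label below `1`. -/
theorem mem_of_isClosed (hf : IsCoalescingPath f D) {C : Set ℝ} (hC : IsClosed C)
    {u w : unitInterval} (huw : u < w) {t : Icc (0 : ℝ) T}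
    (h : ∀ q ∈ D, q ∈ Ioo u w → f q t ∈ C) : f u t ∈ C := by
  have hu : u ∈ closure (Ioo u w ∩ D) := by
    have h1 : Icc u w ⊆ closure (Ioo u w ∩ D) := by
      rw [← closure_Ioo huw.ne]
      exact closure_minimal (hf.dense.open_subset_closure_inter isOpen_Ioo) isClosed_closure
    exact h1 (left_mem_Icc.2 huw.le)
  have hcont : ContinuousWithinAt (fun v => f v t) (Ioo u w ∩ D) u :=
    ((ContinuousEvalConst.continuous_eval_const t).continuousAt.comp_continuousWithinAt
      (hf.cadlag u).1).mono fun v hv => hv.1.1.le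
  exact hC.closure_subset_iff.2 (by rintro _ ⟨q, hq, rfl⟩; exact h q hq.2 hq.1)
    (hcont.mem_closure_image hu)

theorem monotone (hf : IsCoalescingPath f D) (t : Icc (0 : ℝ) T) : Monotone fun u => f u t := by
  have h1 : ∀ u v, v ∈ D → u < v → f u t ≤ f v t := fun u v hv huv =>
    hf.mem_of_isClosed isClosed_Iic huv fun q hq hqm => hf.le_of_mem q hq v hv hqm.2 t
  intro u v huv
  rcases huv.eq_or_lt with rfl | huv
  · exact le_rfl
  -- The label `1` cannot be approached from the right, which is why `1 ∈ D` is required.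
  rcases (unitInterval.le_one' (t := v)).eq_or_lt with rfl | hv
  · exact h1 u 1 hf.one_mem huv
  · exact hf.mem_of_isClosed isClosed_Ici hv fun q hq hqm => h1 u q hq (huv.trans hqm.1)

/-- Monotonicity squeezes all labels between `u` and `v` together at time `s`; those in `D` stay
together, and right continuity carries this to `[u,v)`. The endpoint `v` is lost: limits from the
right say nothing about its link with labels on its left. -/
theorem eq_of_mem_Ico (hf : IsCoalescingPath f D) {u v w : unitInterval} {s t : Icc (0 : ℝ) T}
    (hst : s ≤ t) (h : f u s = f v s) (hw : w ∈ Ico u v) : f w t = f u t := by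
  have huv : u < v := hw.1.trans_lt hw.2
  obtain ⟨q, hqD, hq⟩ := hf.dense.exists_between huv
  have hs : ∀ p ∈ Ioo u v, f p s = f u s := fun p hp =>
    le_antisymm ((hf.monotone s hp.2.le).trans h.ge) (hf.monotone s hp.1.le)
  have key : ∀ x ∈ Ico u v, f x t ∈ ({f q t} : Set ℝ) := fun x hx =>
    hf.mem_of_isClosed isClosed_singleton hx.2 fun p hp hpm =>
      hf.coalesce p hp q hqD s t hst
        ((hs p ⟨hx.1.trans_lt hpm.1, hpm.2⟩).trans (hs q hq).symm)
  exact (key w hw).trans (key u ⟨le_rfl, huv⟩).symm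

/-- The labels that coalesce with the labels on their left. -/
def coalescingLabels (f : unitInterval → C(Icc (0 : ℝ) T, ℝ)) (D : Set unitInterval) :
    Set unitInterval :=
  {u | ∀ q ∈ D, q < u → ∀ s t, s ≤ t → f q s = f u s → f q t = f u t}

theorem mem_coalescingLabels (hf : IsCoalescingPath f D) {u : unitInterval} (hu : u ∈ D) :
    u ∈ coalescingLabels f D :=
  fun q hq _ s t hst h => hf.coalesce q hq u hu s t hst h

/-- Each exceptional label is witnessed by some `q ∈ D` and a dense time `r n`. A pair `(q, n)`
serves at most one label: if a larger label also met `q` by time `r n`, the smaller one would be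
squeezed onto `q` at time `r n`. -/
theorem countable_compl_coalescingLabels (hf : IsCoalescingPath f D) :
    (coalescingLabels f D)ᶜ.Countable := by
  rcases isEmpty_or_nonempty (Icc (0 : ℝ) T) with hι | hι
  · refine countable_empty.mono fun u hu => hu fun _ _ _ s => hι.elim s
  let r := TopologicalSpace.denseSeq (Icc (0 : ℝ) T)
  have hr : DenseRange r := TopologicalSpace.denseRange_denseSeq _
  have hsub : (coalescingLabels f D)ᶜ ⊆ ⋃ q ∈ D, ⋃ n : ℕ,
      {u | q < u ∧ ∃ s ≤ r n, f q s = f u s ∧ f q (r n) ≠ f u (r n)} := by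
    intro u hu
    simp only [coalescingLabels, mem_compl_iff, mem_ofPred_eq, not_forall] at hu
    obtain ⟨q, hq, hqu, s, t, hst, hs, ht⟩ := hu
    have hne : s < t := lt_of_le_of_ne hst (by rintro rfl; exact ht hs)
    obtain ⟨n, hn⟩ := hr.exists_mem_open
      (isOpen_Ioi.inter (isOpen_ne_fun (f q).continuous (f u).continuous)) ⟨t, hne, ht⟩
    exact mem_iUnion₂.2 ⟨q, hq, mem_iUnion.2 ⟨n, hqu, s, le_of_lt hn.1, hs, hn.2⟩⟩
  refine Countable.mono hsub (hf.countable.biUnion fun q _ => countable_iUnion fun n => ?_)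
  refine Set.Subsingleton.countable ?_
  have aux : ∀ u u' : unitInterval, q < u → u < u' →
      (∃ s ≤ r n, f q s = f u' s) → f q (r n) = f u (r n) := by
    rintro u u' hqu huu' ⟨s, hs, h⟩
    exact (hf.eq_of_mem_Ico hs h ⟨hqu.le, huu'⟩).symm
  rintro u ⟨hu, s, hs, hsu, hne⟩ u' ⟨hu', s', hs', hsu', hne'⟩
  rcases lt_trichotomy u u' with h | h | h
  · exact (hne (aux u u' hu h ⟨s', hs', hsu'⟩)).elim
  · exact h
  · exact (hne' (aux u' u hu' h ⟨s, hs, hsu⟩)).elim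

/-- A label that met `u` but is apart from it at time `t` must lie to the right of `u`, since `u`
coalesces with its left. Two such labels are impossible, as the smaller would lie in the half-open
interval that stays with `u`. So the two sets differ by at most one point. -/
theorem mass_eq_clusterMass (hf : IsCoalescingPath f D) {u : unitInterval}
    (hu : u ∈ coalescingLabels f D) (t : Icc (0 : ℝ) T) : mass f u t = clusterMass f u t := by
  have hss : ({v | ∃ s ≤ t, f v s = f u s} \ {v | f v t = f u t}).Subsingleton := by
    have right : ∀ v, (∃ s ≤ t, f v s = f u s) → f v t ≠ f u t → u < v := by
      rintro v ⟨s, hs, h⟩ hne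
      by_contra! hvu
      have hvu : v < u := lt_of_le_of_ne hvu (by rintro rfl; exact hne rfl)
      obtain ⟨q, hqD, hq⟩ := hf.dense.exists_between hvu
      have hqs : f q s = f u s :=
        le_antisymm (hf.monotone s hq.2.le) (h.ge.trans (hf.monotone s hq.1.le))
      exact hne ((hf.eq_of_mem_Ico hs h ⟨hq.1.le, hq.2⟩).symm.trans (hu q hqD hq.2 s t hs hqs))
    have aux : ∀ v v', v < v' → (∃ s ≤ t, f v s = f u s) → f v t ≠ f u t →
        (∃ s ≤ t, f v' s = f u s) → False := by
      rintro v v' hvv' hv hne ⟨s, hs, h⟩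
      exact hne (hf.eq_of_mem_Ico hs h.symm ⟨(right v hv hne).le, hvv'⟩)
    rintro v ⟨hv, hne⟩ v' ⟨hv', hne'⟩
    rcases lt_trichotomy v v' with h | h | h
    · exact (aux v v' h hv hne hv').elim
    · exact h
    · exact (aux v' v h hv' hne' hv).elim
  refine le_antisymm ?_ (measure_mono fun v hv => ⟨t, le_rfl, hv⟩)
  have := hss.measure_zero (volume : Measure unitInterval)
  exact measure_mono_ae (ae_le_set.2 this)

theorem clock_eq (hf : IsCoalescingPath f D) {u : unitInterval}
    (hu : u ∈ coalescingLabels f D) (t : Icc (0 : ℝ) T) :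
    clock f u t = ∫⁻ s in Iic t, (clusterMass f u s)⁻¹ ∂(timeMeasure T) := by
  simp only [clock, hf.mass_eq_clusterMass hu]

theorem ae_mass_eq_clusterMass (hf : IsCoalescingPath f D) :
    ∀ᵐ u : unitInterval, ∀ t, mass f u t = clusterMass f u t := by
  filter_upwards [hf.countable_compl_coalescingLabels.ae_notMem volume] with u hu t
  exact hf.mass_eq_clusterMass (not_not.1 hu) t

/-- A set of positive measure has two points; monotonicity puts every label between them in the same
cluster. -/
theorem exists_eq_of_clusterMass_ne_zero (hf : IsCoalescingPath f D) {a : ℕ → unitInterval}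
    (ha : DenseRange a) {u : unitInterval} {s : Icc (0 : ℝ) T} (h : clusterMass f u s ≠ 0) :
    ∃ k, f (a k) s = f u s := by
  have hns : ¬ {v | f v s = f u s}.Subsingleton := fun hs => h (hs.measure_zero _)
  obtain ⟨v, hv, w, hw, hvw⟩ := (not_subsingleton_iff.1 hns).exists_lt
  obtain ⟨_, ⟨k, rfl⟩, hk⟩ := ha.exists_between hvw
  exact ⟨k, le_antisymm ((hf.monotone s hk.2.le).trans hw.le) (hv.ge.trans (hf.monotone s hk.1.le))⟩

end IsCoalescingPath

end Paths

/-! ### Joint measurability in label, time and randomness -/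

section Measurability

theorem measurable_uncurry_of_rightContinuous {α : Type*} [MeasurableSpace α]
    {g : unitInterval → α → ℝ}
    (hr : ∀ a u, ContinuousWithinAt (fun v => g v a) (Ici u) u) (hm : ∀ u, Measurable (g u)) :
    Measurable (Function.uncurry g) := by
  -- The `+ 1` puts the grid point at or to the right of `u`, so right continuity suffices;
  -- `projIcc` brings back grid points beyond `1`.
  obtain ⟨e, he⟩ : ∃ e : ℕ → ℕ → unitInterval,
      ∀ n k, e n k = projIcc 0 1 zero_le_one (((k : ℝ) + 1) / n) := ⟨_, fun _ _ => rfl⟩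
  refine measurable_of_tendsto_metrizable
    (f := fun n p => g (e n ⌊(p.1 : ℝ) * n⌋₊) p.2) (fun n => ?_) ?_
  · have hG : Measurable fun p : ℕ × α => g (e n p.1) p.2 :=
      measurable_from_prod_countable_right fun k => hm (e n k)
    have hfl : Measurable fun p : unitInterval × α => (⌊(p.1 : ℝ) * n⌋₊, p.2) :=
      Measurable.prodMk (Nat.measurable_floor.comp
        ((measurable_subtype_coe.comp measurable_fst).mul_const _)) measurable_snd
    exact hG.comp hfl
  · refine tendsto_pi_nhds.2 fun ⟨u, a⟩ => ?_
    refine (hr a u).tendsto.comp (tendsto_nhdsWithin_iff.2 ⟨?_, ?_⟩)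
    · have h1 : Tendsto (fun n : ℕ => ((⌊(u : ℝ) * n⌋₊ : ℝ) + 1) / n) atTop (𝓝 (u : ℝ)) := by
        have := ((tendsto_nat_floor_mul_div_atTop u.2.1).comp
          (tendsto_natCast_atTop_atTop (R := ℝ))).add tendsto_one_div_atTop_nhds_zero_nat
        simpa [Function.comp_def, add_div] using this
      have h2 := (continuous_projIcc (a := (0 : ℝ)) (b := 1)
        (h := zero_le_one)).continuousAt.tendsto.comp h1
      simpa [Function.comp_def, projIcc_val, he] using h2
    · filter_upwards [eventually_gt_atTop 0] with n hn
      have hn' : (0 : ℝ) < n := Nat.cast_pos.2 hn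
      have h3 : (u : ℝ) ≤ ((⌊(u : ℝ) * n⌋₊ : ℝ) + 1) / n :=
        (le_div_iff₀ hn').2 (Nat.lt_floor_add_one _).le
      have := monotone_projIcc (zero_le_one (α := ℝ)) h3
      rwa [projIcc_val, ← he] at this

variable {Ω : Type*} [MeasurableSpace Ω] {T : ℝ} {y : Ω → unitInterval → C(Icc (0 : ℝ) T, ℝ)}

theorem IsRandomElement.measurable_uncurry (hy : IsRandomElement y) :
    Measurable fun p : unitInterval × Icc (0 : ℝ) T × Ω => y p.2.2 p.1 p.2.1 := by
  refine measurable_uncurry_of_rightContinuous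
    (g := fun u (p : Icc (0 : ℝ) T × Ω) => y p.2 u p.1) (fun p u => ?_) fun u => ?_
  · exact (ContinuousEvalConst.continuous_eval_const p.1).continuousAt.comp_continuousWithinAt
      (hy.cadlag p.2 u).1
  · exact measurable_uncurry_of_continuous_of_measurable
      (u := fun (s : Icc (0 : ℝ) T) ω => y ω u s) (fun ω => (y ω u).continuous)
      fun s => hy.measurable_coord u s

theorem IsRandomElement.measurable_path (hy : IsRandomElement y) (ω : Ω) :
    Measurable fun p : unitInterval × Icc (0 : ℝ) T => y ω p.1 p.2 :=
  hy.measurable_uncurry.comp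
    (measurable_fst.prodMk (measurable_snd.prodMk measurable_const))

/-- The gain over `mass`: the defining set is an equality of jointly measurable functions, without a
quantifier over times. -/
theorem IsRandomElement.measurable_clusterMass (hy : IsRandomElement y) :
    Measurable fun p : unitInterval × Icc (0 : ℝ) T × Ω => clusterMass (y p.2.2) p.1 p.2.1 := by
  have hs : MeasurableSet {q : (unitInterval × Icc (0 : ℝ) T × Ω) × unitInterval |
      y q.1.2.2 q.2 q.1.2.1 = y q.1.2.2 q.1.1 q.1.2.1} :=
    measurableSet_eq_fun
      (hy.measurable_uncurry.comp (measurable_snd.prodMk (measurable_snd.comp measurable_fst)))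
      (hy.measurable_uncurry.comp measurable_fst)
  exact measurable_measure_prodMk_left hs

theorem IsRandomElement.measurable_clusterMass_path (hy : IsRandomElement y) (ω : Ω) :
    Measurable fun p : unitInterval × Icc (0 : ℝ) T => clusterMass (y ω) p.1 p.2 :=
  hy.measurable_clusterMass.comp
    (measurable_fst.prodMk (measurable_snd.prodMk measurable_const))

/-- `∫_0^t ds / m(u,s)`, with the mass of the cluster of `u`. -/
noncomputable def clusterClock (f : unitInterval → C(Icc (0 : ℝ) T, ℝ)) (u : unitInterval)
    (t : Icc (0 : ℝ) T) : ℝ≥0∞ :=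
  ∫⁻ s in Iic t, (clusterMass f u s)⁻¹ ∂(timeMeasure T)

theorem IsRandomElement.measurable_clusterClock (hy : IsRandomElement y) (t : Icc (0 : ℝ) T) :
    Measurable fun p : unitInterval × Ω => clusterClock (y p.2) p.1 t := by
  refine Measurable.lintegral_prod_right
    (f := fun (p : unitInterval × Ω) s => (clusterMass (y p.2) p.1 s)⁻¹) ?_
  exact (hy.measurable_clusterMass.comp ((measurable_fst.comp measurable_fst).prodMk
    (measurable_snd.prodMk (measurable_snd.comp measurable_fst)))).inv

/-- `∫_0^1 ∫_0^t φ(f(u,s)) / m(u,s) ds du`, with the mass of the cluster of `u`. -/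
noncomputable def clusterIntegral (f : unitInterval → C(Icc (0 : ℝ) T, ℝ))
    (φ : ℝ → ℝ) (t : Icc (0 : ℝ) T) : ℝ :=
  ∫ u : unitInterval, ∫ s in Iic t, φ (f u s) / (clusterMass f u s).toReal ∂(timeMeasure T)

theorem IsRandomElement.measurable_clusterIntegral (hy : IsRandomElement y) {φ : ℝ → ℝ}
    (hφ : Measurable φ) (t : Icc (0 : ℝ) T) :
    Measurable fun ω => clusterIntegral (y ω) φ t := by
  have h : Measurable fun p : unitInterval × Icc (0 : ℝ) T × Ω =>
      φ (y p.2.2 p.1 p.2.1) / (clusterMass (y p.2.2) p.1 p.2.1).toReal :=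
    (hφ.comp hy.measurable_uncurry).div hy.measurable_clusterMass.ennreal_toReal
  refine StronglyMeasurable.measurable ?_
  refine StronglyMeasurable.integral_prod_right (f := fun ω (u : unitInterval) =>
    ∫ s in Iic t, φ (y ω u s) / (clusterMass (y ω) u s).toReal ∂(timeMeasure T)) ?_
  refine StronglyMeasurable.integral_prod_right (f := fun (p : Ω × unitInterval) s =>
    φ (y p.1 p.2 s) / (clusterMass (y p.1) p.2 s).toReal) ?_
  exact (h.comp ((measurable_snd.comp measurable_fst).prodMk
    (measurable_snd.prodMk (measurable_fst.comp measurable_fst)))).stronglyMeasurable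

end Measurability

/-! ### Almost sure path properties and the moment bound on the clock -/

section Flow

variable {Ω : Type*} [MeasurableSpace Ω] {P : Measure Ω} [IsProbabilityMeasure P] {T : ℝ}
  {hT : 0 < T} {y : Ω → unitInterval → C(Icc (0 : ℝ) T, ℝ)}

omit [IsProbabilityMeasure P] in
theorem IsFlow.ae_le (hy : IsFlow hT P y) {u v : unitInterval} (huv : u < v) :
    ∀ᵐ ω ∂P, ∀ t, y ω u t ≤ y ω v t := by
  have : Nonempty (Icc (0 : ℝ) T) := ⟨⟨0, le_rfl, hT.le⟩⟩
  filter_upwards [ae_all_iff.2 fun n =>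
    hy.mono u v huv (TopologicalSpace.denseSeq (Icc (0 : ℝ) T) n)] with ω hω t
  refine (TopologicalSpace.denseRange_denseSeq (Icc (0 : ℝ) T)).induction_on
    (p := fun t => y ω u t ≤ y ω v t) t
    (isClosed_le (y ω u).continuous (y ω v).continuous) hω

theorem IsFlow.ae_coalesce (hy : IsFlow hT P y) {u v : unitInterval} (huv : u < v) :
    ∀ᵐ ω ∂P, ∀ s t, s ≤ t → y ω u s = y ω v s → y ω u t = y ω v t := by
  have h := ae_eq_zero_of_eq_zero_of_le ((hy.martingale v).sub (hy.martingale u))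
    (fun ω => (y ω v).continuous.sub (y ω u).continuous)
    fun t => (hy.mono u v huv t).mono fun ω hω => sub_nonneg.2 hω
  filter_upwards [h] with ω hω s t hst hs
  exact (sub_eq_zero.1 (hω s t hst (sub_eq_zero.2 hs.symm))).symm

theorem IsFlow.ae_isCoalescingPath (hy : IsFlow hT P y) {D : Set unitInterval}
    (hD : D.Countable) (hd : Dense D) (h1 : 1 ∈ D) : ∀ᵐ ω ∂P, IsCoalescingPath (y ω) D := by
  have hle : ∀ᵐ ω ∂P, ∀ u ∈ D, ∀ v ∈ D, u < v → ∀ t, y ω u t ≤ y ω v t := by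
    refine (ae_ball_iff hD).2 fun u _ => (ae_ball_iff hD).2 fun v _ => ?_
    by_cases huv : u < v
    · filter_upwards [hy.ae_le huv] with ω hω _ using hω
    · exact Eventually.of_forall fun ω h => absurd h huv
  have hco : ∀ᵐ ω ∂P, ∀ u ∈ D, ∀ v ∈ D, ∀ s t, s ≤ t → y ω u s = y ω v s →
      y ω u t = y ω v t := by
    refine (ae_ball_iff hD).2 fun u _ => (ae_ball_iff hD).2 fun v _ => ?_
    rcases lt_trichotomy u v with huv | rfl | huv
    · exact hy.ae_coalesce huv
    · exact Eventually.of_forall fun ω _ _ _ _ => rfl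
    · filter_upwards [hy.ae_coalesce huv] with ω hω s t hst hs
      exact (hω s t hst hs.symm).symm
  filter_upwards [hle, hco] with ω h2 h3
  exact ⟨hy.randomElement.cadlag ω, hD, hd, h1, h2, h3⟩

/-- The exceptional null set depends on the countable set of labels, so each application chooses `S`
to contain the labels it needs. -/
theorem IsFlow.exists_ae_isCoalescingPath (hy : IsFlow hT P y) {S : Set unitInterval}
    (hS : S.Countable) : ∃ D, S ⊆ D ∧ ∀ᵐ ω ∂P, IsCoalescingPath (y ω) D := by
  let q := TopologicalSpace.denseSeq unitInterval
  refine ⟨range q ∪ insert 1 S, fun u hu => Or.inr (Or.inr hu), hy.ae_isCoalescingPath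
    ((countable_range q).union (hS.insert 1)) ?_ (Or.inr (Or.inl rfl))⟩
  exact Dense.mono subset_union_left (TopologicalSpace.denseRange_denseSeq unitInterval)

theorem IsFlow.ae_clusterClock_eq (hy : IsFlow hT P y) (u : unitInterval) :
    ∀ᵐ ω ∂P, ∀ t, clock (y ω) u t = clusterClock (y ω) u t := by
  obtain ⟨D, hD, h⟩ := hy.exists_ae_isCoalescingPath (countable_singleton u)
  filter_upwards [h] with ω hω t
  exact hω.clock_eq (hω.mem_coalescingLabels (hD rfl)) t

/-- The martingale `y(u,·)² - clock` has nonnegative mean at time `0`, so `E clock ≤ E y(u,t)²`. As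
`y(u,t)` lies between `y(0,t)` and `y(1,t)`, its square is at most the sum of theirs. The bound is
uniform in `u`, as Tonelli requires. -/
theorem IsFlow.lintegral_clock_le (hy : IsFlow hT P y) (u : unitInterval) (t : Icc (0 : ℝ) T) :
    ∫⁻ ω, clock (y ω) u t ∂P ≤ ENNReal.ofReal (∫ ω, (y ω 0 t ^ 2 + y ω 1 t ^ 2) ∂P) := by
  have hsq : ∀ v s, Integrable (fun ω => y ω v s ^ 2) P := fun v s =>
    (hy.squareIntegrable v s).integrable_sq
  have hq := hy.quadraticVariation u
  have hint : ∀ s, Integrable (fun ω => (clock (y ω) u s).toReal) P := fun s => by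
    have := (hsq u s).sub (hq.martingale.integrable s)
    refine this.congr (Eventually.of_forall fun ω => ?_)
    simp only [Pi.sub_apply]
    ring
  have hle : ∀ w v : unitInterval, w ≤ v → ∀ᵐ ω ∂P, y ω w t ≤ y ω v t := fun w v h => by
    rcases h.eq_or_lt with rfl | h
    · exact Eventually.of_forall fun _ => le_rfl
    · exact hy.mono w v h t
  let z : Icc (0 : ℝ) T := ⟨0, le_rfl, hT.le⟩
  have hmart : ∫ ω, (y ω u z * y ω u z - (clock (y ω) u z).toReal) ∂P =
      ∫ ω, (y ω u t * y ω u t - (clock (y ω) u t).toReal) ∂P := by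
    have := hq.martingale.setIntegral_eq (i := z) (j := t) t.2.1 MeasurableSet.univ
    simpa only [setIntegral_univ] using this
  have hz : 0 ≤ ∫ ω, (y ω u z * y ω u z - (clock (y ω) u z).toReal) ∂P := by
    refine integral_nonneg_of_ae ?_
    filter_upwards [hq.start] with ω hω
    rw [hω z rfl, sub_zero]
    exact mul_self_nonneg _
  calc ∫⁻ ω, clock (y ω) u t ∂P
      = ∫⁻ ω, ENNReal.ofReal (clock (y ω) u t).toReal ∂P := by
        refine lintegral_congr_ae ?_
        filter_upwards [hy.clock_ne_top u] with ω hω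
        exact (ENNReal.ofReal_toReal (hω t)).symm
    _ = ENNReal.ofReal (∫ ω, (clock (y ω) u t).toReal ∂P) :=
        (ofReal_integral_eq_lintegral_ofReal (hint t)
          (Eventually.of_forall fun _ => ENNReal.toReal_nonneg)).symm
    _ ≤ ENNReal.ofReal (∫ ω, y ω u t ^ 2 ∂P) := by
        refine ENNReal.ofReal_le_ofReal ?_
        have h2 : ∫ ω, (y ω u t * y ω u t - (clock (y ω) u t).toReal) ∂P =
            ∫ ω, y ω u t ^ 2 ∂P - ∫ ω, (clock (y ω) u t).toReal ∂P := by
          rw [← integral_sub (hsq u t) (hint t)]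
          simp only [sq]
        linarith
    _ ≤ _ := by
        refine ENNReal.ofReal_le_ofReal
          (integral_mono_ae (hsq u t) ((hsq 0 t).add (hsq 1 t)) ?_)
        filter_upwards [hle 0 u unitInterval.nonneg', hle u 1 unitInterval.le_one'] with ω h0 h1
        rcases le_total 0 (y ω u t) with h | h <;> nlinarith [sq_nonneg (y ω 0 t), sq_nonneg (y ω 1 t)]

theorem IsFlow.ae_lintegral_clusterClock_ne_top (hy : IsFlow hT P y) (t : Icc (0 : ℝ) T) :
    ∀ᵐ ω ∂P, ∫⁻ u, clusterClock (y ω) u t ≠ ∞ := by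
  have hm := hy.randomElement.measurable_clusterClock t
  have hm' : Measurable fun p : Ω × unitInterval => clusterClock (y p.1) p.2 t :=
    hm.comp measurable_swap
  refine (ae_lt_top (hm'.lintegral_prod_right' (ν := volume)) ?_).mono fun ω h => h.ne
  rw [lintegral_lintegral_swap hm'.aemeasurable]
  refine ne_top_of_le_ne_top (ENNReal.ofReal_ne_top
    (r := ∫ ω, (y ω 0 t ^ 2 + y ω 1 t ^ 2) ∂P)) ?_
  calc ∫⁻ u : unitInterval, ∫⁻ ω, clusterClock (y ω) u t ∂P
      ≤ ∫⁻ _ : unitInterval, ENNReal.ofReal (∫ ω, (y ω 0 t ^ 2 + y ω 1 t ^ 2) ∂P) := by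
        refine lintegral_mono fun u => ?_
        refine le_trans (le_of_eq (lintegral_congr_ae ?_)) (hy.lintegral_clock_le u t)
        filter_upwards [hy.ae_clusterClock_eq u] with ω hω using (hω t).symm
    _ = _ := by simp

end Flow

/-! ### The series as a partition of the double integral -/

section Series

variable {T : ℝ} {f : unitInterval → C(Icc (0 : ℝ) T, ℝ)} {D : Set unitInterval}

theorem firstTime_le (hT : 0 < T) {S : Set (Icc (0 : ℝ) T)} {s : Icc (0 : ℝ) T} (hs : s ∈ S) :
    firstTime hT S ≤ s := by
  change sInf (insert T (Subtype.val '' S)) ≤ (s : ℝ)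
  refine csInf_le ⟨0, ?_⟩ (mem_insert_of_mem _ (mem_image_of_mem _ hs))
  rintro x (rfl | ⟨r, _, rfl⟩)
  · exact hT.le
  · exact r.2.1

theorem exists_lt_of_firstTime_lt (hT : 0 < T) {S : Set (Icc (0 : ℝ) T)} {s : Icc (0 : ℝ) T}
    (hs : firstTime hT S < s) : ∃ r ∈ S, r < s := by
  obtain ⟨x, hx, hxs⟩ := exists_lt_of_csInf_lt (insert_nonempty _ _)
    (show sInf (insert T (Subtype.val '' S)) < (s : ℝ) from hs)
  rcases hx with rfl | ⟨r, hr, rfl⟩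
  · exact absurd s.2.2 (not_le.2 hxs)
  · exact ⟨r, hr, hxs⟩

theorem ae_timeMeasure_ne (r : Icc (0 : ℝ) T) : ∀ᵐ s ∂timeMeasure T, s ≠ r := by
  have h : timeMeasure T {r} = 0 := by
    rw [timeMeasure,
      MeasurableEmbedding.comap_apply (MeasurableEmbedding.subtype_coe measurableSet_Icc)]
    simp
  exact compl_mem_ae_iff.2 h

theorem ae_clusterMass_ne_zero (hm : Measurable fun p : unitInterval × Icc (0 : ℝ) T =>
    clusterMass f p.1 p.2) {u : unitInterval} {t : Icc (0 : ℝ) T} (h : clusterClock f u t ≠ ∞) :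
    ∀ᵐ s ∂(timeMeasure T).restrict (Iic t), clusterMass f u s ≠ 0 := by
  have hm' : Measurable fun s => (clusterMass f u s)⁻¹ := (hm.comp measurable_prodMk_left).inv
  filter_upwards [ae_lt_top hm' h] with s hs h0
  simp [h0] at hs

theorem clusterMass_ne_top (u : unitInterval) (s : Icc (0 : ℝ) T) : clusterMass f u s ≠ ∞ :=
  measure_ne_top _ _

variable {t : Icc (0 : ℝ) T} (hm : Measurable fun p : unitInterval × Icc (0 : ℝ) T =>
    clusterMass f p.1 p.2) (hc : ∫⁻ u, clusterClock f u t ≠ ∞)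

include hm hc

theorem lintegral_prod_inv_clusterMass_ne_top :
    ∫⁻ p : unitInterval × Icc (0 : ℝ) T, (clusterMass f p.1 p.2)⁻¹
      ∂(volume.prod ((timeMeasure T).restrict (Iic t))) ≠ ∞ := by
  exact (lintegral_prod _ hm.inv.aemeasurable).trans_ne hc

theorem ae_prod_clusterMass_ne_zero :
    ∀ᵐ p : unitInterval × Icc (0 : ℝ) T ∂(volume.prod ((timeMeasure T).restrict (Iic t))),
      clusterMass f p.1 p.2 ≠ 0 := by
  filter_upwards [ae_lt_top hm.inv (lintegral_prod_inv_clusterMass_ne_top hm hc)] with p hp h0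
  simp [h0] at hp

theorem integrable_div_clusterMass (hf : Measurable fun p : unitInterval × Icc (0 : ℝ) T =>
    f p.1 p.2) {φ : ℝ → ℝ} (hφ : Measurable φ) {C : ℝ} (hC : ∀ x, |φ x| ≤ C) :
    Integrable (fun p : unitInterval × Icc (0 : ℝ) T =>
      φ (f p.1 p.2) / (clusterMass f p.1 p.2).toReal)
      (volume.prod ((timeMeasure T).restrict (Iic t))) := by
  have h := integrable_toReal_of_lintegral_ne_top hm.inv.aemeasurable
    (lintegral_prod_inv_clusterMass_ne_top hm hc)
  simp only [div_eq_mul_inv]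
  refine (h.bdd_mul (c := C) (hφ.comp hf).aestronglyMeasurable
    (Eventually.of_forall fun p => hC _)).congr (Eventually.of_forall fun p => ?_)
  simp [ENNReal.toReal_inv]

theorem IsCoalescingPath.hasSum_seriesTerm (hT : 0 < T) (hcp : IsCoalescingPath f D)
    (hf : Measurable fun p : unitInterval × Icc (0 : ℝ) T => f p.1 p.2) {φ : ℝ → ℝ}
    (hφ : Measurable φ) {C : ℝ} (hC : ∀ x, |φ x| ≤ C) {a : ℕ → unitInterval} (ha : DenseRange a)
    (haD : ∀ k, a k ∈ D) (hac : ∀ k, clusterClock f (a k) t ≠ ∞) :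
    HasSum (seriesTerm hT f φ t a) (clusterIntegral f φ t) := by
  set μ : Measure (unitInterval × Icc (0 : ℝ) T) :=
    volume.prod ((timeMeasure T).restrict (Iic t))
  set F : unitInterval × Icc (0 : ℝ) T → ℝ :=
    fun p => φ (f p.1 p.2) / (clusterMass f p.1 p.2).toReal with hF
  have hFi : Integrable F μ := integrable_div_clusterMass hm hc hf hφ hC
  -- `E k`: the first label of the sequence in the cluster of `p.1` at time `p.2` is `a k`.
  let E : ℕ → Set (unitInterval × Icc (0 : ℝ) T) := fun k =>
    {p | f (a k) p.2 = f p.1 p.2 ∧ ∀ l < k, f (a l) p.2 ≠ f p.1 p.2}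
  have hfa : ∀ k, Measurable fun p : unitInterval × Icc (0 : ℝ) T => f (a k) p.2 := fun k =>
    (f (a k)).continuous.measurable.comp measurable_snd
  have hE : ∀ k, MeasurableSet (E k) := fun k => by
    have : E k = {p | f (a k) p.2 = f p.1 p.2} ∩
        ⋂ l, ⋂ _ : l < k, {p | f (a l) p.2 = f p.1 p.2}ᶜ := by ext; simp [E]
    rw [this]
    refine (measurableSet_eq_fun (hfa k) hf).inter ?_
    exact MeasurableSet.iInter fun l => MeasurableSet.iInter fun _ =>
      (measurableSet_eq_fun (hfa l) hf).compl
  have hdisj : Pairwise (Function.onFun Disjoint E) := by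
    have : ∀ k l, k < l → Disjoint (E k) (E l) := fun k l hkl =>
      Set.disjoint_left.2 fun p hk hl => hl.2 k hkl hk.1
    intro k l hkl
    rcases hkl.lt_or_gt with h | h
    · exact this k l h
    · exact (this l k h).symm
  have hcover : ∀ᵐ p ∂μ, p ∈ ⋃ k, E k := by
    classical
    filter_upwards [ae_prod_clusterMass_ne_zero hm hc] with p hp
    have hex := hcp.exists_eq_of_clusterMass_ne_zero ha hp
    exact mem_iUnion.2 ⟨Nat.find hex, Nat.find_spec hex, fun l hl => Nat.find_min hex hl⟩
  have hsum := hasSum_integral_iUnion hE hdisj hFi.integrableOn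
  rw [setIntegral_eq_integral_of_ae_compl_eq_zero
    (hcover.mono fun p hp hn => absurd hp hn), integral_prod F hFi] at hsum
  suffices hterm : ∀ k, ∫ p in E k, F p ∂μ = seriesTerm hT f φ t a k by
    simp only [hterm] at hsum
    exact hsum
  intro k
  rw [← integral_indicator (hE k), integral_prod_symm _ (hFi.indicator (hE k))]
  let B : Set (Icc (0 : ℝ) T) := {s | ∀ l < k, f (a l) s ≠ f (a k) s}
  have hB : MeasurableSet B := by
    have : B = ⋂ l, ⋂ _ : l < k, {s | f (a l) s = f (a k) s}ᶜ := by ext; simp [B]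
    rw [this]
    exact MeasurableSet.iInter fun l => MeasurableSet.iInter fun _ =>
      (measurableSet_eq_fun (f (a l)).continuous.measurable (f (a k)).continuous.measurable).compl
  have hinner : ∀ᵐ s ∂(timeMeasure T).restrict (Iic t),
      ∫ u, (E k).indicator F (u, s) = B.indicator (fun s => φ (f (a k) s)) s := by
    -- A single label is null in `[0,1]`, so positivity of its mass comes from its own finite clock
    -- `hac k`, not from `hc`.
    filter_upwards [ae_clusterMass_ne_zero hm (hac k)] with s hs
    by_cases hsB : s ∈ B
    · have hfun : (fun u => (E k).indicator F (u, s)) = {u | f u s = f (a k) s}.indicator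
          fun _ => φ (f (a k) s) / (clusterMass f (a k) s).toReal := by
        funext u
        by_cases hu : f u s = f (a k) s
        · have hmem : (u, s) ∈ E k := ⟨hu.symm, fun l hl => by simpa [hu] using hsB l hl⟩
          rw [indicator_of_mem hmem, indicator_of_mem (show u ∈ {u | f u s = f (a k) s} from hu)]
          simp [hF, clusterMass, hu]
        · rw [indicator_of_notMem (fun h => hu h.1.symm),
            indicator_of_notMem (show u ∉ {u | f u s = f (a k) s} from hu)]
      have hset : MeasurableSet {u | f u s = f (a k) s} :=
        measurableSet_eq_fun (hf.comp measurable_prodMk_right) measurable_const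
      rw [hfun, integral_indicator hset, setIntegral_const, indicator_of_mem hsB, smul_eq_mul]
      exact mul_div_cancel₀ _ (ENNReal.toReal_ne_zero.2 ⟨hs, clusterMass_ne_top _ _⟩)
    · rw [indicator_of_notMem hsB]
      refine integral_eq_zero_of_ae (Eventually.of_forall fun u => indicator_of_notMem ?_ _)
      rintro ⟨h1, h2⟩
      exact hsB fun l hl => by simpa [h1] using h2 l hl
  rw [integral_congr_ae hinner, integral_indicator hB, Measure.restrict_restrict hB, seriesTerm]
  refine setIntegral_congr_set ?_
  -- The time `s = τ(a k)` is discarded: it belongs to `Iic` but may already be a meeting time,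
  -- hence outside `B`.
  filter_upwards [ae_timeMeasure_ne (coalescenceTime hT f a k)] with s hs
  refine propext ?_
  change (s ∈ B ∧ s ≤ t) ↔ s ≤ min (coalescenceTime hT f a k) t
  rw [le_min_iff]
  refine and_congr_left fun _ => ⟨fun hsB => ?_, fun hle l hl h => ?_⟩
  · by_contra! hlt
    -- A meeting at `r < s` persists up to `s` by coalescence, contradicting `s ∈ B`.
    obtain ⟨r, ⟨l, hl, hr⟩, hrs⟩ := exists_lt_of_firstTime_lt hT hlt
    exact hsB l hl (hcp.coalesce _ (haD l) _ (haD k) r s hrs.le hr)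
  · exact hs (le_antisymm hle (firstTime_le hT ⟨l, hl, h⟩))

end Series

/-! ### Transfer to the flow and conclusion -/

section Main

variable {Ω : Type*} [MeasurableSpace Ω] {P : Measure Ω} [IsProbabilityMeasure P] {T : ℝ}
  {hT : 0 < T} {y : Ω → unitInterval → C(Icc (0 : ℝ) T, ℝ)}

theorem IsFlow.ae_hasSum_seriesTerm (hy : IsFlow hT P y) {φ : ℝ → ℝ} (hφ : Measurable φ) {C : ℝ}
    (hC : ∀ x, |φ x| ≤ C) (t : Icc (0 : ℝ) T) {a : ℕ → unitInterval} (ha : DenseRange a) :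
    ∀ᵐ ω ∂P, HasSum (seriesTerm hT (y ω) φ t a) (clusterIntegral (y ω) φ t) := by
  obtain ⟨D, hD, hcp⟩ := hy.exists_ae_isCoalescingPath (countable_range a)
  filter_upwards [hcp, hy.ae_lintegral_clusterClock_ne_top t,
    ae_all_iff.2 fun k => hy.ae_clusterClock_eq (a k),
    ae_all_iff.2 fun k => hy.clock_ne_top (a k)] with ω h1 h2 h3 h4
  exact h1.hasSum_seriesTerm (hy.randomElement.measurable_clusterMass_path ω) h2 hT
    (hy.randomElement.measurable_path ω) hφ hC ha (fun k => hD (mem_range_self k))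
    fun k => (h3 k t) ▸ h4 k t

theorem IsFlow.ae_massIntegral_eq (hy : IsFlow hT P y) (φ : ℝ → ℝ) (t : Icc (0 : ℝ) T) :
    ∀ᵐ ω ∂P, massIntegral (y ω) φ t = clusterIntegral (y ω) φ t := by
  obtain ⟨D, -, hcp⟩ := hy.exists_ae_isCoalescingPath countable_empty
  filter_upwards [hcp] with ω h
  refine integral_congr_ae ?_
  filter_upwards [h.ae_mass_eq_clusterMass] with u hu
  simp only [hu]

theorem IsFlow.ae_integrable (hy : IsFlow hT P y) {φ : ℝ → ℝ} (hφ : Measurable φ) {C : ℝ}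
    (hC : ∀ x, |φ x| ≤ C) (t : Icc (0 : ℝ) T) :
    ∀ᵐ ω ∂P,
      (∀ᵐ p : unitInterval × Icc (0 : ℝ) T ∂(volume.prod ((timeMeasure T).restrict (Iic t))),
        mass (y ω) p.1 p.2 ≠ 0) ∧
      Integrable (fun p : unitInterval × Icc (0 : ℝ) T =>
        φ (y ω p.1 p.2) / (mass (y ω) p.1 p.2).toReal)
        (volume.prod ((timeMeasure T).restrict (Iic t))) := by
  obtain ⟨D, -, hcp⟩ := hy.exists_ae_isCoalescingPath countable_empty
  filter_upwards [hcp, hy.ae_lintegral_clusterClock_ne_top t] with ω h1 h2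
  have hm := hy.randomElement.measurable_clusterMass_path ω
  have heq : ∀ᵐ p : unitInterval × Icc (0 : ℝ) T
      ∂(volume.prod ((timeMeasure T).restrict (Iic t))),
      ∀ s, mass (y ω) p.1 s = clusterMass (y ω) p.1 s :=
    Measure.quasiMeasurePreserving_fst.ae h1.ae_mass_eq_clusterMass
  constructor
  · filter_upwards [heq, ae_prod_clusterMass_ne_zero hm h2] with p hp h0
    rwa [hp]
  · refine (integrable_div_clusterMass hm h2
      (hy.randomElement.measurable_path ω) hφ hC).congr ?_
    filter_upwards [heq] with p hp
    rw [hp]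

end Main

end HeavyFlow

theorem mainTheorem7 {Ω : Type*} [MeasurableSpace Ω] (P : Measure Ω) [IsProbabilityMeasure P]
    {T : ℝ} (hT : 0 < T) (y : Ω → unitInterval → C(Icc (0 : ℝ) T, ℝ))
    (hy : HeavyFlow.IsFlow hT P y)
    (φ : ℝ → ℝ) (hφ : Continuous φ) (hφb : ∃ C, ∀ x, |φ x| ≤ C) (t : Icc (0 : ℝ) T) :
    -- the double integral makes sense and converges absolutely
    (∀ᵐ ω ∂P,
      (∀ᵐ p : unitInterval × Icc (0 : ℝ) T ∂(volume.prod ((HeavyFlow.timeMeasure T).restrict (Iic t))),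
        HeavyFlow.mass (y ω) p.1 p.2 ≠ 0) ∧
      Integrable (fun p : unitInterval × Icc (0 : ℝ) T =>
        φ (y ω p.1 p.2) / (HeavyFlow.mass (y ω) p.1 p.2).toReal)
        (volume.prod ((HeavyFlow.timeMeasure T).restrict (Iic t)))) ∧
    -- the series converges
    (∀ u : ℕ → unitInterval, DenseRange u →
      ∀ᵐ ω ∂P, Summable (HeavyFlow.seriesTerm hT (y ω) φ t u)) ∧
    -- its sum does not depend on the dense sequence
    (∀ u v : ℕ → unitInterval, DenseRange u → DenseRange v →
      ∀ᵐ ω ∂P, ∑' k, HeavyFlow.seriesTerm hT (y ω) φ t u k =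
        ∑' k, HeavyFlow.seriesTerm hT (y ω) φ t v k) ∧
    -- its sum is the double integral
    (∀ u : ℕ → unitInterval, DenseRange u →
      ∀ᵐ ω ∂P, ∑' k, HeavyFlow.seriesTerm hT (y ω) φ t u k =
        HeavyFlow.massIntegral (y ω) φ t) ∧
    -- so the integral with respect to the flow exists and equals the double integral
    (∃ J : Ω → ℝ, HeavyFlow.IsFlowIntegral hT P y φ t J) ∧
    (∀ J : Ω → ℝ, HeavyFlow.IsFlowIntegral hT P y φ t J →
      ∀ᵐ ω ∂P, J ω = HeavyFlow.massIntegral (y ω) φ t) := by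
  obtain ⟨C, hC⟩ := hφb
  have hsum := fun (u : ℕ → unitInterval) (hu : DenseRange u) =>
    hy.ae_hasSum_seriesTerm hφ.measurable hC t hu
  -- The flow integral is witnessed by `clusterIntegral`, whose measurability in `ω` is known; it
  -- agrees with `massIntegral` almost surely.
  refine ⟨hy.ae_integrable hφ.measurable hC t, fun u hu => ?_, fun u v hu hv => ?_,
    fun u hu => ?_, ⟨fun ω => HeavyFlow.clusterIntegral (y ω) φ t,
      hy.randomElement.measurable_clusterIntegral hφ.measurable t, hsum⟩, fun J hJ => ?_⟩
  · exact (hsum u hu).mono fun ω h => h.summable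
  · filter_upwards [hsum u hu, hsum v hv] with ω h1 h2
    rw [h1.tsum_eq, h2.tsum_eq]
  · filter_upwards [hsum u hu, hy.ae_massIntegral_eq φ t] with ω h1 h2
    rw [h1.tsum_eq, h2]
  · have hd := TopologicalSpace.denseRange_denseSeq unitInterval
    filter_upwards [hJ.2 _ hd, hsum _ hd, hy.ae_massIntegral_eq φ t] with ω h1 h2 h3
    rw [h1.unique h2, h3]
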